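/- \textbf{Theorem (Equivalence of the norms).} All function classes are on $\mathbb{R}$ with Lebesgue measure, and functions are identified when they agree almost everywhere. For $f\in L^1_{loc}(\mathbb{R})$ put $$\|f\|_{BLO}=\sup_I\Big[\frac1{|I|}\int_I f\,dx-\inf_I f\Big],$$ where $I$ runs over the compact intervals of positive length and $\inf_I f$ is the essential infimum of $f$ over $I$; $f\in BLO$ means that $f\in L^1_{loc}(\mathbb{R})$ and $\|f\|_{BLO}<\infty$. For $g\in L^1_{loc}(\mathbb{R})$ let $Mg(x)=\sup_{I\ni x}\frac1{|I|}\int_I|g(t)|\,dt$ be the Hardy--Littlewood maximal function, where $I$ runs over the compact intervals of positive length containing $x$. Define $$\|f\|'_{BLO}=\inf\{\alpha+\|b\|_\infty:\ \alpha>0,\ b\in L^\infty(\mathbb{R}),\ f=\alpha\log(Mg)+b \text{ a.e. for some } g\in L^1_{loc}(\mathbb{R})\},$$ with $\inf\emptyset=\infty$. Then there are absolute constants $d_1,d_2>0$ such that, for every $f\in BLO$, $$d_1\|f\|_{BLO}\le\|f\|'_{BLO}\le d_2\|f\|_{BLO}.$$ -/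

import Mathlib

open MeasureTheory Set
open scoped ENNReal

noncomputable section

/-- The mean of `f` over `[a, b]` minus the essential infimum of `f` over `[a, b]`, for `a < b`.
The essential infimum is taken in the extended reals, so the value is `∞` when `f` is not
essentially bounded below on `[a, b]`; for locally integrable `f` the difference is never
negative, so `toENNReal` loses nothing. -/
def lowerOscillation (f : ℝ → ℝ) (a b : ℝ) : ℝ≥0∞ :=
  (((⨍ x in Icc a b, f x : ℝ) : EReal) -
    essInf (fun x : ℝ => (f x : EReal)) (volume.restrict (Icc a b))).toENNReal

/-- The usual `BLO` norm: the supremum of the lower oscillations over all compact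
(nondegenerate) intervals. -/
def bloNorm (f : ℝ → ℝ) : ℝ≥0∞ :=
  ⨆ (a : ℝ) (b : ℝ) (_ : a < b), lowerOscillation f a b

/-- Functions of bounded lower oscillation on the line. -/
def IsBLO (f : ℝ → ℝ) : Prop :=
  LocallyIntegrable f volume ∧ bloNorm f < ∞

/-- The (uncentred) Hardy-Littlewood maximal function: the supremum of the means of `|g|` over
all compact intervals containing `x`. -/
def hlMaximal (g : ℝ → ℝ) (x : ℝ) : ℝ≥0∞ :=
  ⨆ (a : ℝ) (b : ℝ) (_ : a < b) (_ : x ∈ Icc a b), ⨍⁻ t in Icc a b, ‖g t‖ₑ ∂volume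

/-- The decomposition `f = α log (M g) + b` almost everywhere, with `α > 0`, `g` locally
integrable and `b` essentially bounded. The logarithm is extended-real valued
(`log 0 = -∞`, `log ∞ = ∞`), so the identity includes that `0 < M g < ∞` almost everywhere. -/
def IsLogMaximalDecomposition (f : ℝ → ℝ) (α : ℝ) (g b : ℝ → ℝ) : Prop :=
  0 < α ∧ LocallyIntegrable g volume ∧ MemLp b ∞ volume ∧
    ∀ᵐ x : ℝ, (f x : EReal) = (α : EReal) * ENNReal.log (hlMaximal g x) + (b x : EReal)

/-- The new norm: the infimum of `α + ‖b‖_∞` over all decompositions `f = α log (M g) + b`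
(it is `∞` if there is none). -/
def bloNorm' (f : ℝ → ℝ) : ℝ≥0∞ :=
  ⨅ (α : ℝ) (g : ℝ → ℝ) (b : ℝ → ℝ) (_ : IsLogMaximalDecomposition f α g b),
    ENNReal.ofReal α + eLpNorm b ∞ volume

end

/-!
If `f` has bounded lower oscillation with constant `N`, a stopping-interval argument and Vitali's
covering lemma show that on every interval `I` the set where `f` exceeds `inf_I f + 21 N n` has
measure at most `4⁻ⁿ |I|`. Hence `w = exp (f / (42 N))` is an `A₁` weight: `w ≤ M w ≤ 10 w` almost
everywhere, so that `f = 42 N log (M w) + b` with `b` bounded by a multiple of `N`.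

Conversely, put `m = inf_I M g`. On intervals meeting `I` and longer than it, the mean of `|g|` is
at most `2 m`, so for `t ≥ 2` only short intervals matter for the set `{M g > t m} ∩ I`, and the
weak type estimate gives it measure at most `15 |I| / t`. Integrating in `log t`, the mean of
`log (M g)` over `I` exceeds `log m` by at most `15`; and bounded lower oscillation is stable under
positive multiples and bounded perturbations.
-/

open Filter Topology Metric

section Covering

theorem measure_le_of_ae_exists_closedBall {X : Type*} [PseudoMetricSpace X]
    [TopologicalSpace.SeparableSpace X] [MeasurableSpace X] [OpensMeasurableSpace X]
    {ρ ν : Measure X} {E S : Set X} {R τ : ℝ} (hτ : 3 < τ)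
    (h : ∀ᵐ x ∂ρ, x ∈ E → ∃ c r, 0 < r ∧ r ≤ R ∧ x ∈ closedBall c r ∧ closedBall c r ⊆ S ∧
      ρ (E ∩ closedBall c (τ * r)) ≤ ν (closedBall c r)) :
    ρ E ≤ ν S := by
  obtain ⟨u, huT, hdisj, hcov⟩ := Vitali.exists_disjoint_subfamily_covering_enlargement_closedBall
    {p : X × ℝ | 0 < p.2 ∧ p.2 ≤ R ∧ closedBall p.1 p.2 ⊆ S ∧
      ρ (E ∩ closedBall p.1 (τ * p.2)) ≤ ν (closedBall p.1 p.2)}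
    Prod.fst Prod.snd R (fun p hp => hp.2.1) τ hτ
  have hcount : u.Countable := hdisj.countable_of_nonempty_interior fun p hp =>
    ⟨p.1, ball_subset_interior_closedBall (mem_ball_self (huT hp).1)⟩
  have hE : E ≤ᵐ[ρ] ⋃ q ∈ u, E ∩ closedBall q.1 (τ * q.2) := by
    filter_upwards [h] with x hx hxE
    obtain ⟨c, r, hr, hrR, hxc, hsub⟩ := hx hxE
    obtain ⟨q, hq, hqsub⟩ := hcov (c, r) ⟨hr, hrR, hsub⟩
    exact mem_biUnion hq ⟨hxE, hqsub hxc⟩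
  calc ρ E ≤ ρ (⋃ q ∈ u, E ∩ closedBall q.1 (τ * q.2)) := measure_mono_ae hE
    _ ≤ ∑' q : u, ρ (E ∩ closedBall q.1.1 (τ * q.1.2)) := measure_biUnion_le _ hcount _
    _ ≤ ∑' q : u, ν (closedBall q.1.1 q.1.2) := ENNReal.tsum_le_tsum fun q => (huT q.2).2.2.2
    _ = ν (⋃ q ∈ u, closedBall q.1 q.2) :=
        (measure_biUnion hcount hdisj fun _ _ => measurableSet_closedBall).symm
    _ ≤ ν S := measure_mono (iUnion₂_subset fun q hq => (huT hq).2.2.1)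

theorem measure_le_of_ae_exists_Icc {ρ ν : Measure ℝ} {E : Set ℝ} {a b : ℝ}
    (h : ∀ᵐ x ∂ρ, x ∈ E → ∃ c d, c < d ∧ x ∈ Icc c d ∧ Icc c d ⊆ Icc a b ∧
      ρ (E ∩ Icc (3 * c - 2 * d) (3 * d - 2 * c)) ≤ ν (Icc c d)) :
    ρ E ≤ ν (Icc a b) := by
  refine measure_le_of_ae_exists_closedBall (R := (b - a) / 2) (τ := 5) (by norm_num) ?_
  filter_upwards [h] with x hx hxE
  obtain ⟨c, d, hcd, hxcd, hsub, hle⟩ := hx hxE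
  have henlarge :
      closedBall ((c + d) / 2) (5 * ((d - c) / 2)) = Icc (3 * c - 2 * d) (3 * d - 2 * c) := by
    rw [Real.closedBall_eq_Icc]
    congr 1 <;> ring
  obtain ⟨hac, hdb⟩ := (Icc_subset_Icc_iff hcd.le).1 hsub
  refine ⟨(c + d) / 2, (d - c) / 2, by linarith, by linarith, ?_⟩
  rw [henlarge, ← Real.Icc_eq_closedBall]
  exact ⟨hxcd, hsub, hle⟩

end Covering

section Interval

variable {f : ℝ → ℝ} {a b : ℝ}

theorem ae_restrict_Icc_neBot (hab : a < b) : (ae (volume.restrict (Icc a b))).NeBot := by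
  rw [ae_neBot, Ne, Measure.restrict_eq_zero, Real.volume_Icc]
  simpa using hab

theorem setAverage_Icc_le_iff (hab : a < b) {C : ℝ} :
    ⨍ x in Icc a b, f x ≤ C ↔ ∫ x in Icc a b, f x ≤ C * (b - a) := by
  rw [setAverage_eq, Real.volume_real_Icc_of_le hab.le, smul_eq_mul, inv_mul_eq_div,
    div_le_iff₀ (sub_pos.2 hab)]

theorem lt_setLAverage_Icc_iff {g : ℝ → ℝ≥0∞} (hab : a < b) {t : ℝ≥0∞} :
    t < ⨍⁻ x in Icc a b, g x ∂volume ↔ t * ENNReal.ofReal (b - a) < ∫⁻ x in Icc a b, g x := by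
  rw [setLAverage_eq, Real.volume_Icc, ENNReal.lt_div_iff_mul_lt (by simp [hab]) (by simp)]

theorem setIntegral_Icc_const (hab : a ≤ b) (c : ℝ) : ∫ _ in Icc a b, c = c * (b - a) := by
  rw [setIntegral_const, Real.volume_real_Icc_of_le hab, smul_eq_mul, mul_comm]

theorem mul_sub_le_setIntegral_Icc (hf : IntegrableOn f (Icc a b)) (hab : a ≤ b) {m : ℝ}
    (hm : ∀ᵐ x ∂volume.restrict (Icc a b), m ≤ f x) :
    m * (b - a) ≤ ∫ x in Icc a b, f x := by
  rw [← setIntegral_Icc_const hab]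
  exact integral_mono_ae (integrable_const m) hf hm

theorem integrableOn_Icc_of_lintegral_sub_ne_top {m : ℝ}
    (hf : AEStronglyMeasurable f (volume.restrict (Icc a b)))
    (hm : ∀ᵐ x ∂volume.restrict (Icc a b), m ≤ f x)
    (hlint : ∫⁻ x in Icc a b, ENNReal.ofReal (f x - m) ≠ ∞) : IntegrableOn f (Icc a b) := by
  have hsub : IntegrableOn (fun x => f x - m) (Icc a b) :=
    (lintegral_ofReal_ne_top_iff_integrable (by fun_prop) (hm.mono fun x hx => sub_nonneg.2 hx)).1
      hlint
  exact (hsub.add (integrable_const m)).congr (.of_forall fun x => sub_add_cancel (f x) m)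

theorem setIntegral_Icc_le_of_lintegral_sub_le (hf : IntegrableOn f (Icc a b)) (hab : a ≤ b)
    {m C : ℝ} (hm : ∀ᵐ x ∂volume.restrict (Icc a b), m ≤ f x) (hC : 0 ≤ C)
    (hlint : ∫⁻ x in Icc a b, ENNReal.ofReal (f x - m) ≤ ENNReal.ofReal (C * (b - a))) :
    ∫ x in Icc a b, f x ≤ (m + C) * (b - a) := by
  have hsub : IntegrableOn (fun x => f x - m) (Icc a b) := hf.sub (integrable_const m)
  rw [← ofReal_integral_eq_lintegral_ofReal hsub (hm.mono fun x hx => sub_nonneg.2 hx),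
    ENNReal.ofReal_le_ofReal_iff (mul_nonneg hC (sub_nonneg.2 hab)),
    integral_sub hf (integrable_const m), setIntegral_Icc_const hab] at hlint
  linarith

theorem ofReal_mul_volume_superlevel_inter_Icc_le (hf : IntegrableOn f (Icc a b)) (hab : a ≤ b)
    {m N : ℝ} (hm : ∀ᵐ x ∂volume.restrict (Icc a b), m ≤ f x)
    (hint : ∫ x in Icc a b, f x ≤ (m + N) * (b - a)) {s : ℝ} (hs : 0 ≤ s) :
    ENNReal.ofReal s * volume ({x | m + s ≤ f x} ∩ Icc a b) ≤ ENNReal.ofReal (N * (b - a)) := by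
  have hsub : IntegrableOn (fun x => f x - m) (Icc a b) := hf.sub (integrable_const m)
  have hmarkov := mul_meas_ge_le_integral_of_nonneg
    (hm.mono fun x hx => sub_nonneg.2 hx) hsub s
  rw [integral_sub hf (integrable_const m), setIntegral_Icc_const hab,
    measureReal_restrict_apply' measurableSet_Icc] at hmarkov
  simp only [le_sub_iff_add_le'] at hmarkov
  rw [← ofReal_measureReal (measure_ne_top_of_subset inter_subset_right (by simp)),
    ← ENNReal.ofReal_mul hs]
  exact ENNReal.ofReal_le_ofReal (by linarith)

theorem exists_Icc_sub_eq_mul_of_lt_hasDerivAt {F : ℝ → ℝ} (hF : Continuous F) {x F' L : ℝ}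
    (hx : x ∈ Icc a b) (hab : a < b) (hF' : HasDerivAt F F' x) (hL : F b - F a ≤ L * (b - a))
    (hLF' : L < F') :
    ∃ c d, c < d ∧ x ∈ Icc c d ∧ Icc c d ⊆ Icc a b ∧ F d - F c = L * (d - c) := by
  let excess : ℝ → ℝ := fun s => F (x + s * (b - x)) - F (x - s * (x - a)) - s * (L * (b - a))
  have hexcess_zero : excess 0 = 0 := by simp [excess]
  have hexcess_one : excess 1 ≤ 0 := by simpa [excess] using hL
  have hderiv : HasDerivAt excess ((F' - L) * (b - a)) 0 := by
    have hright : HasDerivAt (fun s => x + s * (b - x)) (b - x) 0 :=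
      (hasDerivAt_mul_const (b - x)).const_add x
    have hleft : HasDerivAt (fun s => x - s * (x - a)) (-(x - a)) 0 :=
      (hasDerivAt_mul_const (x - a)).const_sub x
    have hFright := HasDerivAt.comp (h₂ := F) (0 : ℝ) (by simpa using hF') hright
    have hFleft := HasDerivAt.comp (h₂ := F) (0 : ℝ) (by simpa using hF') hleft
    exact ((hFright.sub hFleft).sub (hasDerivAt_mul_const (L * (b - a)))).congr_deriv (by ring)
  have hslope : ∀ᶠ s in 𝓝[>] 0, 0 < slope excess 0 s :=
    ((hasDerivWithinAt_iff_tendsto_slope' self_notMem_Ioi).1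
      hderiv.hasDerivWithinAt).eventually_const_lt (mul_pos (sub_pos.2 hLF') (sub_pos.2 hab))
  obtain ⟨s, hs, hs0, hs1⟩ := (hslope.and (Ioo_mem_nhdsGT one_pos)).exists
  have hexcess_pos : 0 < excess s := by
    rw [slope_def_field, hexcess_zero, sub_zero, sub_zero] at hs
    exact (div_pos_iff_of_pos_right hs0).1 hs
  obtain ⟨t, ⟨hst, ht1⟩, ht⟩ : (0 : ℝ) ∈ excess '' Icc s 1 :=
    intermediate_value_Icc' hs1.le (by fun_prop) ⟨hexcess_one, hexcess_pos.le⟩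
  have ht0 : 0 < t := hs0.trans_le hst
  refine ⟨x - t * (x - a), x + t * (b - x), ?_, ⟨?_, ?_⟩, Icc_subset_Icc ?_ ?_, ?_⟩
  · linarith [mul_pos ht0 (sub_pos.2 hab)]
  · linarith [mul_nonneg ht0.le (sub_nonneg.2 hx.1)]
  · linarith [mul_nonneg ht0.le (sub_nonneg.2 hx.2)]
  · linarith [mul_le_of_le_one_left (sub_nonneg.2 hx.1) ht1]
  · linarith [mul_le_of_le_one_left (sub_nonneg.2 hx.2) ht1]
  · simp only [excess] at ht
    linarith

theorem ae_exists_Icc_setIntegral_eq (hf : LocallyIntegrable f volume) (hab : a < b) {L : ℝ}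
    (hL : ∫ x in Icc a b, f x ≤ L * (b - a)) :
    ∀ᵐ x, x ∈ Icc a b → L < f x → ∃ c d, c < d ∧ x ∈ Icc c d ∧ Icc c d ⊆ Icc a b ∧
      ∫ y in Icc c d, f y = L * (d - c) := by
  have hfint (u v : ℝ) : IntervalIntegrable f volume u v :=
    (hf.integrableOn_isCompact isCompact_uIcc).intervalIntegrable
  let F : ℝ → ℝ := fun z => ∫ y in a..z, f y
  have hF : Continuous F := intervalIntegral.continuous_primitive hfint a
  have hF_sub {c d : ℝ} (hcd : c ≤ d) : F d - F c = ∫ y in Icc c d, f y := by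
    rw [intervalIntegral.integral_interval_sub_left (hfint _ _) (hfint _ _),
      intervalIntegral.integral_of_le hcd, integral_Icc_eq_integral_Ioc]
  filter_upwards [LocallyIntegrable.ae_hasDerivAt_integral hf] with x hderiv hx hLx
  obtain ⟨c, d, hcd, hxcd, hsub, heq⟩ := exists_Icc_sub_eq_mul_of_lt_hasDerivAt hF hx hab
    (hderiv a) ((hF_sub hab.le).trans_le hL) hLx
  exact ⟨c, d, hcd, hxcd, hsub, (hF_sub hcd.le).symm.trans heq⟩

end Interval

/-- The quantitative form of bounded lower oscillation: on every compact interval the mean of `f`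
exceeds some essential lower bound of `f` by at most `N`. For `0 ≤ N` this says `bloNorm f ≤ N`,
in terms of real numbers only. -/
def IsBLOWith (N : ℝ) (f : ℝ → ℝ) : Prop :=
  ∀ a b, a < b → ∃ m, (∀ᵐ x ∂volume.restrict (Icc a b), m ≤ f x) ∧
    ∫ x in Icc a b, f x ≤ (m + N) * (b - a)

section BLO

variable {f g : ℝ → ℝ} {a b : ℝ} {N : ℝ}

theorem lowerOscillation_le_ofReal_iff (hab : a < b) (hN : 0 ≤ N) :
    lowerOscillation f a b ≤ ENNReal.ofReal N ↔
      ∃ m, (∀ᵐ x ∂volume.restrict (Icc a b), m ≤ f x) ∧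
        ∫ x in Icc a b, f x ≤ (m + N) * (b - a) := by
  have := ae_restrict_Icc_neBot hab
  simp only [← setAverage_Icc_le_iff hab, lowerOscillation]
  constructor
  · intro hosc
    have hae : ∀ᵐ x ∂volume.restrict (Icc a b),
        essInf (fun x : ℝ => (f x : EReal)) (volume.restrict (Icc a b)) ≤ (f x : EReal) :=
      ae_essInf_le
    generalize essInf (fun x : ℝ => (f x : EReal)) (volume.restrict (Icc a b)) = e at hosc hae
    induction e with
    | bot => simp at hosc
    | top =>
      obtain ⟨x, hx⟩ := hae.exists
      simp at hx
    | coe m =>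
      refine ⟨m, hae.mono fun x hx => EReal.coe_le_coe_iff.1 hx, ?_⟩
      rw [← EReal.coe_sub, EReal.toENNReal_of_ne_top (EReal.coe_ne_top _), EReal.toReal_coe,
        ENNReal.ofReal_le_ofReal_iff hN, sub_le_iff_le_add'] at hosc
      exact hosc
  · rintro ⟨m, hm, hmean⟩
    have hm_le : (m : EReal) ≤ essInf (fun x : ℝ => (f x : EReal)) (volume.restrict (Icc a b)) :=
      le_essInf_of_ae_le _ (hm.mono fun x hx => EReal.coe_le_coe_iff.2 hx)
    refine (EReal.toENNReal_le_toENNReal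
      (EReal.sub_le_sub (EReal.coe_le_coe_iff.2 hmean) hm_le)).trans_eq ?_
    rw [← EReal.coe_sub, EReal.toENNReal_of_ne_top (EReal.coe_ne_top _), EReal.toReal_coe,
      add_sub_cancel_left]

theorem bloNorm_le_ofReal_iff (hN : 0 ≤ N) :
    bloNorm f ≤ ENNReal.ofReal N ↔ IsBLOWith N f := by
  simp only [bloNorm, iSup_le_iff, IsBLOWith]
  exact forall₃_congr fun a b hab => lowerOscillation_le_ofReal_iff hab hN

namespace IsBLOWith

theorem congr_ae (hf : IsBLOWith N f) (hfg : f =ᵐ[volume] g) : IsBLOWith N g := by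
  intro a b hab
  obtain ⟨m, hm, hint⟩ := hf a b hab
  have hfg' := ae_restrict_of_ae (s := Icc a b) hfg
  refine ⟨m, ?_, (integral_congr_ae hfg').symm.trans_le hint⟩
  filter_upwards [hm, hfg'] with x hx hfgx using hx.trans_eq hfgx

theorem const_mul (hf : IsBLOWith N f) {α : ℝ} (hα : 0 ≤ α) :
    IsBLOWith (α * N) (fun x => α * f x) := by
  intro a b hab
  obtain ⟨m, hm, hint⟩ := hf a b hab
  refine ⟨α * m, hm.mono fun x hx => mul_le_mul_of_nonneg_left hx hα, ?_⟩
  rw [integral_const_mul, ← mul_add, mul_assoc]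
  exact mul_le_mul_of_nonneg_left hint hα

theorem add_of_abs_le (hf : IsBLOWith N f) (hfint : LocallyIntegrable f volume)
    (hgint : LocallyIntegrable g volume) {B : ℝ} (hB : ∀ᵐ x, |g x| ≤ B) :
    IsBLOWith (N + 2 * B) (f + g) := by
  intro a b hab
  obtain ⟨m, hm, hint⟩ := hf a b hab
  have hB' := ae_restrict_of_ae (s := Icc a b) hB
  have hgI : IntegrableOn g (Icc a b) := hgint.integrableOn_isCompact isCompact_Icc
  have hgle : ∫ x in Icc a b, g x ≤ B * (b - a) := by
    rw [← setIntegral_Icc_const hab.le]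
    exact integral_mono_ae hgI (integrable_const B) (hB'.mono fun x hx => (abs_le.1 hx).2)
  refine ⟨m - B, ?_, ?_⟩
  · filter_upwards [hm, hB'] with x hmx hBx
    rw [Pi.add_apply]
    linarith [(abs_le.1 hBx).1]
  · rw [integral_add' (hfint.integrableOn_isCompact isCompact_Icc) hgI]
    linarith

theorem ae_le_of_le_setIntegral (hf : IsBLOWith N f) (hab : a < b) {s : ℝ}
    (hs : (s + N) * (b - a) ≤ ∫ x in Icc a b, f x) :
    ∀ᵐ x ∂volume.restrict (Icc a b), s ≤ f x := by
  obtain ⟨m, hm, hint⟩ := hf a b hab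
  have hsm : s + N ≤ m + N := le_of_mul_le_mul_right (hs.trans hint) (sub_pos.2 hab)
  exact hm.mono fun x hx => (le_of_add_le_add_right hsm).trans hx

theorem ofReal_mul_volume_superlevel_le (hf : IsBLOWith N f) (hfint : IntegrableOn f (Icc a b))
    {c d s : ℝ} (hcd : c < d) (hsub : Icc c d ⊆ Icc a b)
    (hint : ∫ x in Icc c d, f x ≤ s * (d - c)) {t : ℝ} (ht : 0 ≤ t) :
    ENNReal.ofReal t * volume ({x | s + t ≤ f x} ∩ Icc a b) ≤ ENNReal.ofReal (N * (b - a)) := by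
  have hab : a < b := by
    have := (Icc_subset_Icc_iff hcd.le).1 hsub
    linarith
  obtain ⟨m, hm, hint_ab⟩ := hf a b hab
  have hms : m ≤ s := le_of_mul_le_mul_right
    ((mul_sub_le_setIntegral_Icc (hfint.mono_set hsub) hcd.le
      (ae_restrict_of_ae_restrict_of_subset hsub hm)).trans hint) (sub_pos.2 hcd)
  refine le_trans ?_ (ofReal_mul_volume_superlevel_inter_Icc_le hfint hab.le hm hint_ab ht)
  gcongr

theorem volume_superlevel_le_of_length_le (hf : IsBLOWith N f) (hfint : IntegrableOn f (Icc a b))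
    (hN : 0 < N) {c d s : ℝ} (hcd : c < d) (hsub : Icc c d ⊆ Icc a b)
    (hlen : b - a ≤ 5 * (d - c)) (hint : ∫ x in Icc c d, f x ≤ s * (d - c)) :
    volume ({x | s + 20 * N ≤ f x} ∩ Icc a b) ≤ 4⁻¹ * ENNReal.ofReal (d - c) := by
  have hmarkov := hf.ofReal_mul_volume_superlevel_le hfint hcd hsub hint (t := 20 * N)
    (by positivity)
  refine (ENNReal.mul_le_mul_iff_right (by simpa using hN) ENNReal.ofReal_ne_top).1
    (hmarkov.trans ?_)
  have hquarter : (4⁻¹ : ℝ≥0∞) = ENNReal.ofReal 4⁻¹ := by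
    rw [ENNReal.ofReal_inv_of_pos (by norm_num), ENNReal.ofReal_ofNat]
  rw [hquarter, ← ENNReal.ofReal_mul (by norm_num), ← ENNReal.ofReal_mul (by positivity)]
  exact ENNReal.ofReal_le_ofReal (by nlinarith)

-- Every point where `f` is large lies in an interval on which `f` has mean exactly `s + N`. There
-- `f ≥ s` almost everywhere, while on its fivefold enlargement the essential infimum of `f` is
-- still at most `s + N`, so that `{s + 21 * N ≤ f}` occupies little of it.
theorem volume_superlevel_add_le (hf : IsBLOWith N f) (hfint : LocallyIntegrable f volume)
    (hN : 0 < N) (hab : a < b) {s : ℝ} (hs : ∫ x in Icc a b, f x ≤ (s + N) * (b - a)) :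
    volume ({x | s + 21 * N ≤ f x} ∩ Icc a b) ≤ 4⁻¹ * volume ({x | s ≤ f x} ∩ Icc a b) := by
  let ν : Measure ℝ := (4⁻¹ : ℝ≥0∞) • volume.restrict {x | s ≤ f x}
  have hν (c d : ℝ) : ν (Icc c d) = 4⁻¹ * volume ({x | s ≤ f x} ∩ Icc c d) := by
    rw [Measure.smul_apply, Measure.restrict_apply measurableSet_Icc, inter_comm, smul_eq_mul]
  rw [← hν]
  refine measure_le_of_ae_exists_Icc ?_
  filter_upwards [ae_exists_Icc_setIntegral_eq hfint hab hs] with x hinterval ⟨hxf, hxI⟩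
  obtain ⟨c, d, hcd, hxcd, hsub, hmean⟩ :=
    hinterval hxI (by linarith [show s + 21 * N ≤ f x from hxf])
  refine ⟨c, d, hcd, hxcd, hsub, ?_⟩
  have hfull : Icc c d ≤ᵐ[volume] ({x | s ≤ f x} ∩ Icc c d : Set ℝ) := by
    filter_upwards [(ae_restrict_iff' measurableSet_Icc).1
      (hf.ae_le_of_le_setIntegral hcd hmean.ge)] with y hy hycd using ⟨hy hycd, hycd⟩
  have hsub_enlarged : Icc c d ⊆ Icc (max a (3 * c - 2 * d)) (min b (3 * d - 2 * c)) := by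
    rw [← Icc_inter_Icc]
    exact subset_inter hsub (Icc_subset_Icc (by linarith) (by linarith))
  have hlen : min b (3 * d - 2 * c) - max a (3 * c - 2 * d) ≤ 5 * (d - c) := by
    linarith [min_le_right b (3 * d - 2 * c), le_max_right a (3 * c - 2 * d)]
  rw [inter_assoc, Icc_inter_Icc, hν, show s + 21 * N = s + N + 20 * N by ring]
  calc _ ≤ 4⁻¹ * ENNReal.ofReal (d - c) := hf.volume_superlevel_le_of_length_le
        (hfint.integrableOn_isCompact isCompact_Icc) hN hcd hsub_enlarged hlen hmean.le
    _ ≤ 4⁻¹ * volume ({x | s ≤ f x} ∩ Icc c d) := by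
        rw [← Real.volume_Icc]
        exact mul_le_mul_right (measure_mono_ae hfull) _

theorem volume_superlevel_le (hf : IsBLOWith N f) (hfint : LocallyIntegrable f volume)
    (hN : 0 < N) (hab : a < b) {s : ℝ} (hs : ∫ x in Icc a b, f x ≤ (s + N) * (b - a)) (n : ℕ) :
    volume ({x | s + 21 * N * n ≤ f x} ∩ Icc a b) ≤ 4⁻¹ ^ n * ENNReal.ofReal (b - a) := by
  induction n with
  | zero =>
    rw [pow_zero, one_mul, ← Real.volume_Icc]
    exact measure_mono inter_subset_right
  | succ n ih =>
    have hs' : ∫ x in Icc a b, f x ≤ (s + 21 * N * n + N) * (b - a) := by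
      refine hs.trans (mul_le_mul_of_nonneg_right ?_ (sub_nonneg.2 hab.le))
      have : 0 ≤ 21 * N * n := by positivity
      linarith
    calc volume ({x | s + 21 * N * (n + 1 : ℕ) ≤ f x} ∩ Icc a b)
        = volume ({x | s + 21 * N * n + 21 * N ≤ f x} ∩ Icc a b) := by
          push_cast
          ring_nf
      _ ≤ 4⁻¹ * volume ({x | s + 21 * N * n ≤ f x} ∩ Icc a b) :=
          hf.volume_superlevel_add_le hfint hN hab hs'
      _ ≤ 4⁻¹ * (4⁻¹ ^ n * ENNReal.ofReal (b - a)) := by gcongr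
      _ = 4⁻¹ ^ (n + 1) * ENNReal.ofReal (b - a) := by rw [pow_succ', mul_assoc]

end IsBLOWith

end BLO

section MeasureSpace

variable {Ω : Type*} [MeasurableSpace Ω] {μ : Measure Ω} {y : Ω → ℝ} {D : ℝ≥0∞}

theorem ae_abs_le_toReal_eLpNorm_top (hy : MemLp y ∞ μ) :
    ∀ᵐ x ∂μ, |y x| ≤ (eLpNorm y ∞ μ).toReal := by
  filter_upwards [ae_le_eLpNormEssSup (f := y) (μ := μ)] with x hx
  rw [← eLpNorm_exponent_top, Real.enorm_eq_ofReal_abs] at hx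
  exact (ENNReal.ofReal_le_iff_le_toReal hy.eLpNorm_ne_top).1 hx

theorem ofReal_exp_half_le_one_add_tsum (t : ℝ) :
    ENNReal.ofReal (Real.exp (t / 2)) ≤
      1 + ∑' n : ℕ, (2 : ℝ≥0∞) ^ (n + 1) * (Ici (n : ℝ)).indicator 1 t := by
  rcases le_or_gt t 0 with ht | ht
  · refine le_add_right ?_
    rw [← ENNReal.ofReal_one]
    exact ENNReal.ofReal_le_ofReal (Real.exp_le_one_iff.2 (by linarith))
  · refine le_add_left (le_trans ?_ (ENNReal.le_tsum ⌊t⌋₊))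
    rw [indicator_of_mem (mem_Ici.2 (Nat.floor_le ht.le)), Pi.one_apply, mul_one]
    have hexp_half : Real.exp (1 / 2) ≤ 2 := by
      rw [← Real.le_log_iff_exp_le two_pos]
      linarith [Real.log_two_gt_d9]
    have hexp : Real.exp (t / 2) ≤ 2 ^ (⌊t⌋₊ + 1) := by
      calc Real.exp (t / 2) ≤ Real.exp ((⌊t⌋₊ + 1 : ℕ) * (1 / 2)) := by
            apply Real.exp_le_exp.2
            push_cast
            linarith [Nat.lt_floor_add_one t]
        _ = Real.exp (1 / 2) ^ (⌊t⌋₊ + 1) := Real.exp_nat_mul _ _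
        _ ≤ 2 ^ (⌊t⌋₊ + 1) := by gcongr
    refine (ENNReal.ofReal_le_ofReal hexp).trans_eq ?_
    rw [ENNReal.ofReal_pow two_pos.le, ENNReal.ofReal_ofNat]

theorem lintegral_exp_half_le (hy : AEMeasurable y μ)
    (htail : ∀ n : ℕ, μ {x | (n : ℝ) ≤ y x} ≤ 4⁻¹ ^ n * D) :
    ∫⁻ x, ENNReal.ofReal (Real.exp (y x / 2)) ∂μ ≤ μ univ + 4 * D := by
  have hmeas (n : ℕ) : NullMeasurableSet {x | (n : ℝ) ≤ y x} μ :=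
    hy.nullMeasurable measurableSet_Ici
  have hratio : (2 * 4⁻¹ : ℝ≥0∞) = 2⁻¹ := by
    rw [show (4 : ℝ≥0∞) = 2 * 2 by norm_num, ENNReal.mul_inv (by simp) (by simp), ← mul_assoc,
      ENNReal.mul_inv_cancel (by simp) (by simp), one_mul]
  calc ∫⁻ x, ENNReal.ofReal (Real.exp (y x / 2)) ∂μ
      ≤ ∫⁻ x, (1 + ∑' n : ℕ, (2 : ℝ≥0∞) ^ (n + 1) * {x | (n : ℝ) ≤ y x}.indicator 1 x) ∂μ :=
        lintegral_mono fun x => ofReal_exp_half_le_one_add_tsum (y x)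
    _ = μ univ + ∑' n : ℕ, (2 : ℝ≥0∞) ^ (n + 1) * μ {x | (n : ℝ) ≤ y x} := by
        rw [lintegral_add_left measurable_const, lintegral_one, lintegral_tsum]
        · congr 1
          refine tsum_congr fun n => ?_
          rw [← lintegral_indicator_one₀ (hmeas n)]
          exact lintegral_const_mul'' _ (aemeasurable_one.indicator₀ (hmeas n))
        · exact fun n => (aemeasurable_one.indicator₀ (hmeas n)).const_mul _
    _ ≤ μ univ + ∑' n : ℕ, 2 * D * 2⁻¹ ^ n := by
        refine add_le_add le_rfl (ENNReal.tsum_le_tsum fun n => ?_)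
        calc (2 : ℝ≥0∞) ^ (n + 1) * μ {x | (n : ℝ) ≤ y x}
            ≤ 2 ^ (n + 1) * (4⁻¹ ^ n * D) := by gcongr; exact htail n
          _ = 2 * D * (2 * 4⁻¹) ^ n := by rw [mul_pow]; ring
          _ = 2 * D * 2⁻¹ ^ n := by rw [hratio]
    _ = μ univ + 4 * D := by
        rw [ENNReal.tsum_mul_left, ENNReal.tsum_geometric, ENNReal.one_sub_inv_two, inv_inv]
        ring

theorem lintegral_ofReal_le_of_exp_mul_meas_lt_le (hy0 : 0 ≤ᵐ[μ] y) (hy : AEMeasurable y μ)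
    (htail : ∀ t : ℝ, 0 < t → ENNReal.ofReal (Real.exp t) * μ {x | t < y x} ≤ D) :
    ∫⁻ x, ENNReal.ofReal (y x) ∂μ ≤ D := by
  calc ∫⁻ x, ENNReal.ofReal (y x) ∂μ
      = ∫⁻ t in Ioi 0, μ {x | t < y x} := lintegral_eq_lintegral_meas_lt μ hy0 hy
    _ ≤ ∫⁻ t in Ioi (0 : ℝ), D * ENNReal.ofReal (Real.exp (-t)) := by
        refine setLIntegral_mono' measurableSet_Ioi fun t ht => ?_
        rw [Real.exp_neg, ENNReal.ofReal_inv_of_pos (Real.exp_pos t), ← div_eq_mul_inv]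
        exact ENNReal.le_div_iff_mul_le (by simp [Real.exp_pos]) (by simp) |>.2
          ((mul_comm _ _).trans_le (htail t ht))
    _ = D := by
        rw [lintegral_const_mul _ (by fun_prop), ← ofReal_integral_eq_lintegral_ofReal
          (integrableOn_exp_neg_Ioi 0) (.of_forall fun t => Real.exp_nonneg _),
          integral_exp_neg_Ioi_zero, ENNReal.ofReal_one, mul_one]

end MeasureSpace

section Maximal

variable {g : ℝ → ℝ} {a b : ℝ}

theorem lt_hlMaximal_iff {t : ℝ≥0∞} {x : ℝ} :
    t < hlMaximal g x ↔ ∃ c d, c < d ∧ x ∈ Icc c d ∧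
      t * ENNReal.ofReal (d - c) < ∫⁻ y in Icc c d, ‖g y‖ₑ := by
  simp only [hlMaximal, lt_iSup_iff]
  refine exists₂_congr fun c d => ?_
  rw [exists_prop]
  exact and_congr_right fun hcd => by rw [exists_prop, lt_setLAverage_Icc_iff hcd]

theorem setLAverage_enorm_le_hlMaximal {x : ℝ} (hab : a < b) (hx : x ∈ Icc a b) :
    ⨍⁻ t in Icc a b, ‖g t‖ₑ ∂volume ≤ hlMaximal g x :=
  le_iSup_of_le a <| le_iSup_of_le b <| le_iSup_of_le hab <| le_iSup_of_le hx le_rfl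

theorem lowerSemicontinuous_hlMaximal (g : ℝ → ℝ) : LowerSemicontinuous (hlMaximal g) := by
  intro x t ht
  obtain ⟨c, d, hcd, hx, hlt⟩ := lt_hlMaximal_iff.1 ht
  have hlim : Tendsto (fun ε : ℝ => t * ENNReal.ofReal (d + ε - (c - ε))) (𝓝[>] 0)
      (𝓝 (t * ENNReal.ofReal (d - c))) := by
    refine ENNReal.Tendsto.const_mul (tendsto_nhdsWithin_of_tendsto_nhds ?_) (Or.inr ht.ne_top)
    exact ENNReal.tendsto_ofReal (Continuous.tendsto' (by fun_prop) _ _ (by simp))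
  obtain ⟨ε, hlt_ε, hε : 0 < ε⟩ :=
    ((hlim.eventually_lt_const hlt).and self_mem_nhdsWithin).exists
  filter_upwards [Ioo_mem_nhds (show c - ε < x by linarith [hx.1])
    (show x < d + ε by linarith [hx.2])] with z hz
  exact lt_hlMaximal_iff.2 ⟨c - ε, d + ε, by linarith, Ioo_subset_Icc_self hz,
    hlt_ε.trans_le (lintegral_mono_set (Icc_subset_Icc (by linarith) (by linarith)))⟩

theorem measurable_hlMaximal (g : ℝ → ℝ) : Measurable (hlMaximal g) :=
  (lowerSemicontinuous_hlMaximal g).measurable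

theorem ae_enorm_le_hlMaximal (hg : LocallyIntegrable g volume) :
    ∀ᵐ x, ‖g x‖ₑ ≤ hlMaximal g x := by
  have hgnorm : LocallyIntegrable (fun x => ‖g x‖) volume := fun x => (hg x).norm
  filter_upwards [IsUnifLocDoublingMeasure.ae_tendsto_average (μ := volume) hgnorm 1] with x hx
  have hball : ∀ᶠ r in 𝓝[>] (0 : ℝ), x ∈ closedBall x (1 * r) := by
    filter_upwards [self_mem_nhdsWithin] with r (hr : 0 < r)
    exact mem_closedBall_self (by linarith)
  rw [← ofReal_norm]
  refine le_of_tendsto (ENNReal.tendsto_ofReal (hx (fun _ => x) id tendsto_id hball)) ?_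
  filter_upwards [self_mem_nhdsWithin] with r (hr : 0 < r)
  rw [ofReal_setAverage (hgnorm.integrableOn_isCompact (isCompact_closedBall _ _))
    (.of_forall fun y => norm_nonneg (g y)), ← setLAverage_eq, id, Real.closedBall_eq_Icc]
  simp_rw [ofReal_norm]
  exact setLAverage_enorm_le_hlMaximal (by linarith) ⟨by linarith, by linarith⟩

theorem setLIntegral_enorm_le_iInf_hlMaximal_mul {c d : ℝ} (hcd : c < d)
    (hsub : Icc a b ⊆ Icc c d) :
    ∫⁻ x in Icc c d, ‖g x‖ₑ ≤ (⨅ x ∈ Icc a b, hlMaximal g x) * ENNReal.ofReal (d - c) := by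
  rw [← Real.volume_Icc, ← ENNReal.div_le_iff (by simp [hcd]) (by simp), ← setLAverage_eq]
  exact le_iInf₂ fun x hx => setLAverage_enorm_le_hlMaximal hcd (hsub hx)

theorem iInf_hlMaximal_ne_zero {x : ℝ} (hx : hlMaximal g x ≠ 0) :
    ⨅ x ∈ Icc a b, hlMaximal g x ≠ 0 := by
  intro hzero
  obtain ⟨c, d, hcd, -, hlt⟩ := lt_hlMaximal_iff.1 (pos_iff_ne_zero.2 hx)
  refine hlt.not_ge ?_
  calc ∫⁻ y in Icc c d, ‖g y‖ₑ ≤ ∫⁻ y in Icc (min a c) (max b d), ‖g y‖ₑ :=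
        lintegral_mono_set (Icc_subset_Icc (min_le_right _ _) (le_max_right _ _))
    _ ≤ (⨅ x ∈ Icc a b, hlMaximal g x) * ENNReal.ofReal (max b d - min a c) :=
        setLIntegral_enorm_le_iInf_hlMaximal_mul
          ((min_le_right _ _).trans_lt (hcd.trans_le (le_max_right _ _)))
          (Icc_subset_Icc (min_le_left _ _) (le_max_left _ _))
    _ = 0 * ENNReal.ofReal (d - c) := by rw [hzero, zero_mul, zero_mul]

end Maximal

section LogMaximal

variable {f g : ℝ → ℝ} {a b : ℝ}

-- The convex hull of `Icc a b` and a longer interval meeting it is at most twice as long as the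
-- latter, so the mean of `|g|` over that interval is at most `2 * m`.
theorem exists_Icc_length_le_of_lt_hlMaximal {m t : ℝ≥0∞}
    (hm : ∀ c d, c < d → Icc a b ⊆ Icc c d →
      ∫⁻ x in Icc c d, ‖g x‖ₑ ≤ m * ENNReal.ofReal (d - c))
    (ht : 2 ≤ t) {x : ℝ} (hx : x ∈ Icc a b) (htx : t * m < hlMaximal g x) :
    ∃ c d, c < d ∧ d - c ≤ b - a ∧ x ∈ Icc c d ∧
      t * m * ENNReal.ofReal (d - c) < ∫⁻ y in Icc c d, ‖g y‖ₑ := by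
  obtain ⟨c, d, hcd, hxcd, hlt⟩ := lt_hlMaximal_iff.1 htx
  refine ⟨c, d, hcd, ?_, hxcd, hlt⟩
  by_contra! hlen
  have hhull : max b d - min a c ≤ 2 * (d - c) := by
    rcases max_cases b d with hmax | hmax <;> rcases min_cases a c with hmin | hmin <;>
      linarith [hx.1, hx.2, hxcd.1, hxcd.2]
  refine hlt.not_ge ?_
  calc ∫⁻ y in Icc c d, ‖g y‖ₑ ≤ ∫⁻ y in Icc (min a c) (max b d), ‖g y‖ₑ :=
        lintegral_mono_set (Icc_subset_Icc (min_le_right _ _) (le_max_right _ _))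
    _ ≤ m * ENNReal.ofReal (max b d - min a c) :=
        hm _ _ ((min_le_right _ _).trans_lt (hcd.trans_le (le_max_right _ _)))
          (Icc_subset_Icc (min_le_left _ _) (le_max_left _ _))
    _ ≤ m * ENNReal.ofReal (2 * (d - c)) := by gcongr
    _ = 2 * m * ENNReal.ofReal (d - c) := by
        rw [ENNReal.ofReal_mul zero_le_two, ENNReal.ofReal_ofNat]
        ring
    _ ≤ t * m * ENNReal.ofReal (d - c) := by gcongr

theorem mul_volume_lt_hlMaximal_inter_Icc_le_of_two_le {m t : ℝ≥0∞} (hm0 : m ≠ 0) (hmtop : m ≠ ∞)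
    (hab : a < b)
    (hm : ∀ c d, c < d → Icc a b ⊆ Icc c d →
      ∫⁻ x in Icc c d, ‖g x‖ₑ ≤ m * ENNReal.ofReal (d - c)) (ht : 2 ≤ t) :
    t * volume ({x | t * m < hlMaximal g x} ∩ Icc a b) ≤ 15 * ENNReal.ofReal (b - a) := by
  let ρ : Measure ℝ := (t * m) • volume
  let ν : Measure ℝ := (5 : ℝ≥0∞) • volume.withDensity fun x => ‖g x‖ₑ
  have hν (c d : ℝ) : ν (Icc c d) = 5 * ∫⁻ x in Icc c d, ‖g x‖ₑ := by
    rw [Measure.smul_apply, withDensity_apply _ measurableSet_Icc, smul_eq_mul]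
  have hweak : ρ ({x | t * m < hlMaximal g x} ∩ Icc a b) ≤ ν (Icc (2 * a - b) (2 * b - a)) := by
    refine measure_le_of_ae_exists_Icc (.of_forall fun x ⟨htx, hx⟩ => ?_)
    obtain ⟨c, d, hcd, hlen, hxcd, hlt⟩ := exists_Icc_length_le_of_lt_hlMaximal hm ht hx htx
    refine ⟨c, d, hcd, hxcd, Icc_subset_Icc (by linarith [hx.1, hxcd.2])
      (by linarith [hx.2, hxcd.1]), (measure_mono inter_subset_right).trans ?_⟩
    calc ρ (Icc (3 * c - 2 * d) (3 * d - 2 * c)) = t * m * ENNReal.ofReal (5 * (d - c)) := by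
          rw [Measure.smul_apply, Real.volume_Icc, smul_eq_mul]
          ring_nf
      _ = 5 * (t * m * ENNReal.ofReal (d - c)) := by
          rw [ENNReal.ofReal_mul (by norm_num), ENNReal.ofReal_ofNat]
          ring
      _ ≤ ν (Icc c d) := by
          rw [hν]
          gcongr
  refine (ENNReal.mul_le_mul_iff_right hm0 hmtop).1 ?_
  calc m * (t * volume ({x | t * m < hlMaximal g x} ∩ Icc a b))
      = ρ ({x | t * m < hlMaximal g x} ∩ Icc a b) := by
        rw [Measure.smul_apply, smul_eq_mul]
        ring
    _ ≤ 5 * ∫⁻ x in Icc (2 * a - b) (2 * b - a), ‖g x‖ₑ := hweak.trans_eq (hν _ _)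
    _ ≤ 5 * (m * ENNReal.ofReal (2 * b - a - (2 * a - b))) := by
        gcongr
        exact hm _ _ (by linarith) (Icc_subset_Icc (by linarith) (by linarith))
    _ = m * (15 * ENNReal.ofReal (b - a)) := by
        rw [show 2 * b - a - (2 * a - b) = 3 * (b - a) by ring, ENNReal.ofReal_mul (by norm_num),
          ENNReal.ofReal_ofNat]
        ring

theorem mul_volume_lt_hlMaximal_inter_Icc_le {m t : ℝ≥0∞} (hm0 : m ≠ 0) (hmtop : m ≠ ∞)
    (hab : a < b)
    (hm : ∀ c d, c < d → Icc a b ⊆ Icc c d →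
      ∫⁻ x in Icc c d, ‖g x‖ₑ ≤ m * ENNReal.ofReal (d - c)) :
    t * volume ({x | t * m < hlMaximal g x} ∩ Icc a b) ≤ 15 * ENNReal.ofReal (b - a) := by
  rcases le_total 2 t with ht | ht
  · exact mul_volume_lt_hlMaximal_inter_Icc_le_of_two_le hm0 hmtop hab hm ht
  · have hsub : volume ({x | t * m < hlMaximal g x} ∩ Icc a b) ≤ ENNReal.ofReal (b - a) :=
      (measure_mono inter_subset_right).trans_eq Real.volume_Icc
    exact mul_le_mul' (ht.trans (by norm_num)) hsub

theorem ae_log_le_log_hlMaximal {m : ℝ} (hm0 : 0 < m)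
    (hm : ⨅ x ∈ Icc a b, hlMaximal g x = ENNReal.ofReal m) (hfin : ∀ᵐ x, hlMaximal g x ≠ ∞) :
    ∀ᵐ x ∂volume.restrict (Icc a b), Real.log m ≤ Real.log (hlMaximal g x).toReal := by
  filter_upwards [ae_restrict_of_ae hfin, ae_restrict_mem measurableSet_Icc] with x htop hx
  exact Real.log_le_log hm0 ((ENNReal.ofReal_le_iff_le_toReal htop).1
    (hm.symm.trans_le (iInf₂_le x hx)))

theorem exp_mul_volume_lt_log_hlMaximal_sub_le {m : ℝ} (hm0 : 0 < m)
    (hm : ⨅ x ∈ Icc a b, hlMaximal g x = ENNReal.ofReal m) (hab : a < b) (t : ℝ) :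
    ENNReal.ofReal (Real.exp t) *
        volume ({x | t < Real.log (hlMaximal g x).toReal - Real.log m} ∩ Icc a b) ≤
      15 * ENNReal.ofReal (b - a) := by
  have hsub : {x | t < Real.log (hlMaximal g x).toReal - Real.log m} ∩ Icc a b ⊆
      {x | ENNReal.ofReal (Real.exp t) * ENNReal.ofReal m < hlMaximal g x} ∩ Icc a b := by
    rintro x ⟨hx : t < _, hxI⟩
    refine ⟨?_, hxI⟩
    change _ < hlMaximal g x
    rw [← ENNReal.ofReal_mul (Real.exp_nonneg t)]
    by_cases htop : hlMaximal g x = ∞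
    · exact htop ▸ ENNReal.ofReal_lt_top
    have hpos : 0 < (hlMaximal g x).toReal := hm0.trans_le
      ((ENNReal.ofReal_le_iff_le_toReal htop).1 (hm.symm.trans_le (iInf₂_le x hxI)))
    rw [ENNReal.ofReal_lt_iff_lt_toReal (by positivity) htop,
      ← Real.log_lt_log_iff (by positivity) hpos, Real.log_mul (Real.exp_pos t).ne' hm0.ne',
      Real.log_exp]
    exact lt_sub_iff_add_lt.1 hx
  refine (mul_le_mul_right (measure_mono hsub) _).trans
    (mul_volume_lt_hlMaximal_inter_Icc_le (ENNReal.ofReal_pos.2 hm0).ne' ENNReal.ofReal_ne_top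
      hab fun c d hcd hsub => hm ▸ setLIntegral_enorm_le_iInf_hlMaximal_mul hcd hsub)

theorem lintegral_log_hlMaximal_sub_le {m : ℝ} (hm0 : 0 < m)
    (hm : ⨅ x ∈ Icc a b, hlMaximal g x = ENNReal.ofReal m) (hfin : ∀ᵐ x, hlMaximal g x ≠ ∞)
    (hab : a < b) :
    ∫⁻ x in Icc a b, ENNReal.ofReal (Real.log (hlMaximal g x).toReal - Real.log m) ≤
      15 * ENNReal.ofReal (b - a) := by
  refine lintegral_ofReal_le_of_exp_mul_meas_lt_le
    ((ae_log_le_log_hlMaximal hm0 hm hfin).mono fun x hx => sub_nonneg.2 hx)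
    ((measurable_hlMaximal g).ennreal_toReal.log.sub_const _).aemeasurable fun t _ => ?_
  rw [Measure.restrict_apply' measurableSet_Icc]
  exact exp_mul_volume_lt_log_hlMaximal_sub_le hm0 hm hab t

theorem exists_ae_le_log_hlMaximal_lintegral_sub_le (hpos : ∀ᵐ x, hlMaximal g x ≠ 0)
    (hfin : ∀ᵐ x, hlMaximal g x ≠ ∞) (hab : a < b) :
    ∃ m, (∀ᵐ x ∂volume.restrict (Icc a b), m ≤ Real.log (hlMaximal g x).toReal) ∧
      ∫⁻ x in Icc a b, ENNReal.ofReal (Real.log (hlMaximal g x).toReal - m) ≤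
        15 * ENNReal.ofReal (b - a) := by
  have := ae_restrict_Icc_neBot hab
  obtain ⟨x₀, hx₀⟩ := hpos.exists
  obtain ⟨x₁, hx₁top, hx₁⟩ := ((ae_restrict_of_ae (s := Icc a b) hfin).and
    (ae_restrict_mem measurableSet_Icc)).exists
  have hinf_top : ⨅ x ∈ Icc a b, hlMaximal g x ≠ ∞ :=
    ne_top_of_le_ne_top hx₁top (iInf₂_le x₁ hx₁)
  have hm0 := ENNReal.toReal_pos (iInf_hlMaximal_ne_zero hx₀) hinf_top
  have hm := (ENNReal.ofReal_toReal hinf_top).symm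
  exact ⟨_, ae_log_le_log_hlMaximal hm0 hm hfin, lintegral_log_hlMaximal_sub_le hm0 hm hfin hab⟩

theorem locallyIntegrable_log_hlMaximal (hpos : ∀ᵐ x, hlMaximal g x ≠ 0)
    (hfin : ∀ᵐ x, hlMaximal g x ≠ ∞) :
    LocallyIntegrable (fun x => Real.log (hlMaximal g x).toReal) volume := by
  intro x
  obtain ⟨m, hm, hlint⟩ :=
    exists_ae_le_log_hlMaximal_lintegral_sub_le hpos hfin (show x - 1 < x + 1 by linarith)
  refine ⟨Icc (x - 1) (x + 1), Icc_mem_nhds (by linarith) (by linarith),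
    integrableOn_Icc_of_lintegral_sub_ne_top ?_ hm (ne_top_of_le_ne_top (by finiteness) hlint)⟩
  exact (measurable_hlMaximal g).ennreal_toReal.log.aestronglyMeasurable

theorem isBLOWith_log_hlMaximal (hpos : ∀ᵐ x, hlMaximal g x ≠ 0)
    (hfin : ∀ᵐ x, hlMaximal g x ≠ ∞) :
    IsBLOWith 15 fun x => Real.log (hlMaximal g x).toReal := by
  intro a b hab
  obtain ⟨m, hm, hlint⟩ := exists_ae_le_log_hlMaximal_lintegral_sub_le hpos hfin hab
  refine ⟨m, hm, setIntegral_Icc_le_of_lintegral_sub_le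
    ((locallyIntegrable_log_hlMaximal hpos hfin).integrableOn_isCompact isCompact_Icc)
    hab.le hm (by norm_num) ?_⟩
  rwa [ENNReal.ofReal_mul (by norm_num), ENNReal.ofReal_ofNat]

namespace IsLogMaximalDecomposition

variable {α : ℝ} {u : ℝ → ℝ}

theorem ae_eq (h : IsLogMaximalDecomposition f α g u) :
    ∀ᵐ x, hlMaximal g x ≠ 0 ∧ hlMaximal g x ≠ ∞ ∧
      f x = α * Real.log (hlMaximal g x).toReal + u x := by
  filter_upwards [h.2.2.2] with x hx
  have hpos : hlMaximal g x ≠ 0 := fun hzero => by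
    rw [hzero, ENNReal.log_zero, EReal.coe_mul_bot_of_pos h.1, EReal.bot_add] at hx
    exact EReal.coe_ne_bot _ hx
  have hfin : hlMaximal g x ≠ ∞ := fun htop => by
    rw [htop, ENNReal.log_top, EReal.coe_mul_top_of_pos h.1, EReal.top_add_coe] at hx
    exact EReal.coe_ne_top _ hx
  rw [ENNReal.log_pos_real hpos hfin, ← EReal.coe_mul, ← EReal.coe_add] at hx
  exact ⟨hpos, hfin, EReal.coe_injective hx⟩

theorem bloNorm_le (h : IsLogMaximalDecomposition f α g u) :
    bloNorm f ≤ 15 * (ENNReal.ofReal α + eLpNorm u ∞ volume) := by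
  have hpos : ∀ᵐ x, hlMaximal g x ≠ 0 := h.ae_eq.mono fun x hx => hx.1
  have hfin : ∀ᵐ x, hlMaximal g x ≠ ∞ := h.ae_eq.mono fun x hx => hx.2.1
  obtain ⟨hα, -, hu, -⟩ := id h
  set B := (eLpNorm u ∞ volume).toReal with hB
  have hB0 : 0 ≤ B := ENNReal.toReal_nonneg
  have hf : IsBLOWith (α * 15 + 2 * B) f :=
    (((isBLOWith_log_hlMaximal hpos hfin).const_mul hα.le).add_of_abs_le
      ((locallyIntegrable_log_hlMaximal hpos hfin).smul α) (hu.locallyIntegrable le_top)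
      (ae_abs_le_toReal_eLpNorm_top hu)).congr_ae (h.ae_eq.mono fun x hx => hx.2.2.symm)
  rw [← ENNReal.ofReal_toReal hu.eLpNorm_ne_top, ← hB, ← ENNReal.ofReal_add hα.le hB0,
    ← ENNReal.ofReal_ofNat 15, ← ENNReal.ofReal_mul (by norm_num)]
  exact ((bloNorm_le_ofReal_iff (by positivity)).2 hf).trans
    (ENNReal.ofReal_le_ofReal (by linarith))

end IsLogMaximalDecomposition

theorem bloNorm_le_bloNorm' (f : ℝ → ℝ) : bloNorm f ≤ 15 * bloNorm' f := by
  rw [← ENNReal.div_le_iff' (by norm_num) (by norm_num)]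
  exact le_iInf₂ fun α g => le_iInf₂ fun u h => ENNReal.div_le_of_le_mul' h.bloNorm_le

end LogMaximal

/-- A Muckenhoupt `A₁` weight with constant `C`: the maximal function of `w` is almost everywhere
at most `C * w`. Weights are taken to be positive at every point, so that their logarithms are
meaningful everywhere. -/
structure IsA1Weight (C : ℝ) (w : ℝ → ℝ) : Prop where
  pos (x : ℝ) : 0 < w x
  locallyIntegrable : LocallyIntegrable w volume
  ae_hlMaximal_le : ∀ᵐ x, hlMaximal w x ≤ ENNReal.ofReal (C * w x)

section A1Weight

variable {f w : ℝ → ℝ} {C N : ℝ}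

-- Every interval lies in one with rational endpoints and at most twice its length, so that only
-- countably many exceptional null sets are involved.
theorem ae_hlMaximal_le_two_mul {W : ℝ → ℝ≥0∞}
    (hW : ∀ a b, a < b → ∀ᵐ x ∂volume.restrict (Icc a b),
      ∫⁻ t in Icc a b, ‖w t‖ₑ ≤ W x * ENNReal.ofReal (b - a)) :
    ∀ᵐ x, hlMaximal w x ≤ 2 * W x := by
  have hrat : ∀ᵐ x, ∀ p q : ℚ, (p : ℝ) < q → x ∈ Icc (p : ℝ) q →
      ∫⁻ t in Icc (p : ℝ) q, ‖w t‖ₑ ≤ W x * ENNReal.ofReal (q - p) := by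
    simp only [ae_all_iff, eventually_imp_distrib_left]
    exact fun p q hpq => (ae_restrict_iff' measurableSet_Icc).1 (hW p q hpq)
  filter_upwards [hrat] with x hx
  refine iSup₂_le fun a b => iSup₂_le fun hab hxab => ?_
  obtain ⟨p, hp, hpa⟩ := exists_rat_btwn (show a - (b - a) / 2 < a by linarith)
  obtain ⟨q, hbq, hq⟩ := exists_rat_btwn (show b < b + (b - a) / 2 by linarith)
  rw [setLAverage_eq, Real.volume_Icc]
  refine ENNReal.div_le_of_le_mul ?_
  calc ∫⁻ t in Icc a b, ‖w t‖ₑ ≤ ∫⁻ t in Icc (p : ℝ) q, ‖w t‖ₑ :=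
        lintegral_mono_set (Icc_subset_Icc hpa.le hbq.le)
    _ ≤ W x * ENNReal.ofReal (q - p) :=
        hx p q (by linarith) ⟨hpa.le.trans hxab.1, hxab.2.trans hbq.le⟩
    _ ≤ W x * ENNReal.ofReal (2 * (b - a)) := by
        gcongr
        linarith
    _ = 2 * W x * ENNReal.ofReal (b - a) := by
        rw [ENNReal.ofReal_mul zero_le_two, ENNReal.ofReal_ofNat]
        ring

theorem isA1Weight_of_forall_Icc (hpos : ∀ x, 0 < w x) (hmeas : AEStronglyMeasurable w volume)
    (hw : ∀ a b, a < b → ∀ᵐ x ∂volume.restrict (Icc a b),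
      ∫⁻ t in Icc a b, ‖w t‖ₑ ≤ ENNReal.ofReal (C * w x) * ENNReal.ofReal (b - a)) :
    IsA1Weight (2 * C) w where
  pos := hpos
  locallyIntegrable x := by
    have hlt : x - 1 < x + 1 := by linarith
    have := ae_restrict_Icc_neBot hlt
    obtain ⟨y, hy⟩ := (hw _ _ hlt).exists
    exact ⟨Icc (x - 1) (x + 1), Icc_mem_nhds (by linarith) (by linarith), hmeas.restrict,
      hy.trans_lt (by finiteness)⟩
  ae_hlMaximal_le := by
    filter_upwards [ae_hlMaximal_le_two_mul hw] with x hx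
    rwa [mul_assoc, ENNReal.ofReal_mul zero_le_two, ENNReal.ofReal_ofNat]

theorem IsBLOWith.lintegral_exp_sub_le (hf : IsBLOWith N f) (hfint : LocallyIntegrable f volume)
    (hN : 0 < N) {a b s : ℝ} (hab : a < b) (hs : ∫ x in Icc a b, f x ≤ (s + N) * (b - a)) :
    ∫⁻ x in Icc a b, ENNReal.ofReal (Real.exp ((f x - s) / (42 * N))) ≤
      5 * ENNReal.ofReal (b - a) := by
  have hmeas : AEMeasurable f volume := hfint.aestronglyMeasurable.aemeasurable
  have htail (n : ℕ) : volume.restrict (Icc a b) {x | (n : ℝ) ≤ (f x - s) / (21 * N)} ≤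
      4⁻¹ ^ n * ENNReal.ofReal (b - a) := by
    rw [Measure.restrict_apply' measurableSet_Icc]
    simp_rw [le_div_iff₀' (show 0 < 21 * N by positivity), le_sub_iff_add_le']
    exact hf.volume_superlevel_le hfint hN hab hs n
  have hexp := lintegral_exp_half_le ((hmeas.sub_const s).div_const _).restrict htail
  simp only [div_div, show 21 * N * 2 = 42 * N by ring] at hexp
  refine hexp.trans_eq ?_
  rw [Measure.restrict_apply_univ, Real.volume_Icc]
  ring

theorem IsBLOWith.isA1Weight_exp (hf : IsBLOWith N f) (hfint : LocallyIntegrable f volume)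
    (hN : 0 < N) : IsA1Weight 10 fun x => Real.exp (f x / (42 * N)) := by
  rw [show (10 : ℝ) = 2 * 5 by norm_num]
  have hmeas : AEMeasurable f volume := hfint.aestronglyMeasurable.aemeasurable
  refine isA1Weight_of_forall_Icc (fun x => Real.exp_pos _)
    (hmeas.div_const _).exp.aestronglyMeasurable fun a b hab => ?_
  obtain ⟨m, hm, hint⟩ := hf a b hab
  filter_upwards [hm] with x hx
  simp_rw [Real.enorm_of_nonneg (Real.exp_nonneg _)]
  calc ∫⁻ t in Icc a b, ENNReal.ofReal (Real.exp (f t / (42 * N)))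
      = ∫⁻ t in Icc a b, ENNReal.ofReal (Real.exp (m / (42 * N))) *
          ENNReal.ofReal (Real.exp ((f t - m) / (42 * N))) := by
        simp_rw [← ENNReal.ofReal_mul (Real.exp_nonneg _), ← Real.exp_add, ← add_div,
          add_sub_cancel]
    _ = ENNReal.ofReal (Real.exp (m / (42 * N))) *
          ∫⁻ t in Icc a b, ENNReal.ofReal (Real.exp ((f t - m) / (42 * N))) :=
        lintegral_const_mul' _ _ ENNReal.ofReal_ne_top
    _ ≤ ENNReal.ofReal (Real.exp (f x / (42 * N))) * (5 * ENNReal.ofReal (b - a)) := by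
        gcongr
        exact hf.lintegral_exp_sub_le hfint hN hab hint
    _ = ENNReal.ofReal (5 * Real.exp (f x / (42 * N))) * ENNReal.ofReal (b - a) := by
        rw [ENNReal.ofReal_mul (by norm_num), ENNReal.ofReal_ofNat]
        ring

namespace IsA1Weight

theorem ae_log_hlMaximal_sub_log_mem_Icc (hw : IsA1Weight C w) :
    ∀ᵐ x, hlMaximal w x ≠ 0 ∧ hlMaximal w x ≠ ∞ ∧
      Real.log (hlMaximal w x).toReal - Real.log (w x) ∈ Icc 0 (Real.log C) := by
  filter_upwards [ae_enorm_le_hlMaximal hw.locallyIntegrable, hw.ae_hlMaximal_le] with x hle hge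
  have hpos := hw.pos x
  have hfin : hlMaximal w x ≠ ∞ := ne_top_of_le_ne_top ENNReal.ofReal_ne_top hge
  rw [Real.enorm_of_nonneg hpos.le] at hle
  have hne : hlMaximal w x ≠ 0 := ((ENNReal.ofReal_pos.2 hpos).trans_le hle).ne'
  have hle' : w x ≤ (hlMaximal w x).toReal := (ENNReal.ofReal_le_iff_le_toReal hfin).1 hle
  have hCw : 0 < C * w x := ENNReal.ofReal_pos.1 ((pos_iff_ne_zero.2 hne).trans_le hge)
  have hC : 0 < C := (pos_iff_pos_of_mul_pos hCw).2 hpos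
  have hge' : (hlMaximal w x).toReal ≤ C * w x := ENNReal.toReal_le_of_le_ofReal hCw.le hge
  refine ⟨hne, hfin, sub_nonneg.2 (Real.log_le_log hpos hle'), sub_le_iff_le_add.2 ?_⟩
  rw [← Real.log_mul hC.ne' hpos.ne']
  exact Real.log_le_log (hpos.trans_le hle') hge'

theorem bloNorm'_const_mul_log_le (hw : IsA1Weight C w) {α : ℝ} (hα : 0 < α) :
    bloNorm' (fun x => α * Real.log (w x)) ≤ ENNReal.ofReal (α * (1 + Real.log C)) := by
  let u : ℝ → ℝ := fun x => α * Real.log (w x) - α * Real.log (hlMaximal w x).toReal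
  have hu : ∀ᵐ x, ‖u x‖ ≤ α * Real.log C := by
    filter_upwards [hw.ae_log_hlMaximal_sub_log_mem_Icc] with x ⟨_, _, hlog⟩
    rw [show u x = _ from (mul_sub _ _ _).symm, norm_mul, Real.norm_of_nonneg hα.le,
      norm_sub_rev, Real.norm_of_nonneg hlog.1]
    exact mul_le_mul_of_nonneg_left hlog.2 hα.le
  have hu_meas : AEStronglyMeasurable u volume :=
    ((hw.locallyIntegrable.aestronglyMeasurable.aemeasurable.log.const_mul α).sub
      ((measurable_hlMaximal w).ennreal_toReal.log.const_mul α).aemeasurable).aestronglyMeasurable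
  have hdecomp : IsLogMaximalDecomposition (fun x => α * Real.log (w x)) α w u := by
    refine ⟨hα, hw.locallyIntegrable, memLp_top_of_bound hu_meas _ hu, ?_⟩
    filter_upwards [hw.ae_log_hlMaximal_sub_log_mem_Icc] with x ⟨hne, hfin, _⟩
    rw [ENNReal.log_pos_real hne hfin, ← EReal.coe_mul, ← EReal.coe_add, add_sub_cancel]
  have hlogC : 0 ≤ Real.log C := by
    obtain ⟨x, -, -, hlog⟩ := hw.ae_log_hlMaximal_sub_log_mem_Icc.exists
    exact hlog.1.trans hlog.2
  calc bloNorm' (fun x => α * Real.log (w x)) ≤ ENNReal.ofReal α + eLpNorm u ∞ volume :=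
        iInf₂_le_of_le α w (iInf₂_le_of_le u hdecomp le_rfl)
    _ ≤ ENNReal.ofReal α + ENNReal.ofReal (α * Real.log C) := by
        gcongr
        simpa using eLpNorm_le_of_ae_bound (p := ∞) hu
    _ = ENNReal.ofReal (α * (1 + Real.log C)) := by
        rw [← ENNReal.ofReal_add hα.le (by positivity), mul_one_add]

end IsA1Weight

theorem IsBLOWith.bloNorm'_le (hf : IsBLOWith N f) (hfint : LocallyIntegrable f volume)
    (hN : 0 < N) : bloNorm' f ≤ ENNReal.ofReal (420 * N) := by
  have hlog : Real.log 10 ≤ 9 :=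
    (Real.log_le_sub_one_of_pos (by norm_num)).trans_eq (by norm_num)
  calc bloNorm' f = bloNorm' fun x => 42 * N * Real.log (Real.exp (f x / (42 * N))) := by
        simp_rw [Real.log_exp, mul_div_cancel₀ _ (show 42 * N ≠ 0 by positivity)]
    _ ≤ ENNReal.ofReal (42 * N * (1 + Real.log 10)) :=
        (hf.isA1Weight_exp hfint hN).bloNorm'_const_mul_log_le (by positivity)
    _ ≤ ENNReal.ofReal (420 * N) := ENNReal.ofReal_le_ofReal (by nlinarith)

theorem bloNorm'_le_bloNorm (hf : LocallyIntegrable f volume) : bloNorm' f ≤ 420 * bloNorm f := by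
  rw [← ENNReal.div_le_iff' (by norm_num) (by norm_num)]
  refine le_of_forall_gt_imp_ge_of_dense fun c hc => ?_
  induction c with
  | top => exact le_top
  | coe N =>
    have hN : 0 < (N : ℝ) := by exact_mod_cast zero_le.trans_lt hc
    rw [← ENNReal.ofReal_coe_nnreal] at hc ⊢
    refine ENNReal.div_le_of_le_mul' ?_
    rw [← ENNReal.ofReal_ofNat 420, ← ENNReal.ofReal_mul (by norm_num)]
    exact ((bloNorm_le_ofReal_iff hN.le).1 hc.le).bloNorm'_le hf hN

end A1Weight

theorem mainTheorem2_general :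
    ∃ d₁ d₂ : ℝ, 0 < d₁ ∧ 0 < d₂ ∧ ∀ f : ℝ → ℝ, LocallyIntegrable f volume →
      ENNReal.ofReal d₁ * bloNorm f ≤ bloNorm' f ∧
      bloNorm' f ≤ ENNReal.ofReal d₂ * bloNorm f := by
  refine ⟨15⁻¹, 420, by norm_num, by norm_num, fun f hf => ⟨?_, ?_⟩⟩
  · rw [ENNReal.ofReal_inv_of_pos (by norm_num), ENNReal.ofReal_ofNat,
      ENNReal.inv_mul_le_iff (by norm_num) (by norm_num)]
    exact bloNorm_le_bloNorm' f
  · rw [ENNReal.ofReal_ofNat]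
    exact bloNorm'_le_bloNorm hf

theorem mainTheorem2 :
    ∃ d₁ d₂ : ℝ, 0 < d₁ ∧ 0 < d₂ ∧ ∀ f : ℝ → ℝ, IsBLO f →
      ENNReal.ofReal d₁ * bloNorm f ≤ bloNorm' f ∧
      bloNorm' f ≤ ENNReal.ofReal d₂ * bloNorm f := by
  obtain ⟨d₁, d₂, hd₁, hd₂, h⟩ := mainTheorem2_general
  exact ⟨d₁, d₂, hd₁, hd₂, fun f hf => h f hf.1⟩
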